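/- For a finite commutative ring $R$ and a positive integer $m$, a sequence over $R$ is a finite unordered collection of elements of $R$ with repetition allowed, its length $|S|$ being the number of its terms counted with multiplicity. For $S=(g_1,\dots,g_\ell)$ put $e_m(S)=\sum_{1\le i_1<\dots<i_m\le \ell} g_{i_1}\cdots g_{i_m}$. Let $\mathsf{D}_m(R)$ denote the smallest positive integer $z$ such that every sequence $S$ over $R$ of length $|S|\ge z$ contains a subsequence $S'$ of length $|S'|\ge m$ with $e_m(S')=0$ in $R$. Theorem. Let $k$ and $r$ be positive integers such that $k$ is odd, $r\mid k$ and $k\mid r^2$. Then $\mathsf{D}_2(\mathbb{Z}_k)\le k+r$, where $\mathbb{Z}_k=\mathbb{Z}/k\mathbb{Z}$. -/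

import Mathlib

/-- Sequences over a commutative ring `R`, taken up to order and with repetition allowed, are
multisets over `R`. The property `HasVanishingSubseq m S` says that `S` has a subsequence `T` of
length at least `m` with `e_m(T) = 0`, where `e_m` is the `m`-th elementary symmetric sum. -/
def HasVanishingSubseq {R : Type*} [CommRing R] (m : ℕ) (S : Multiset R) : Prop :=
  ∃ T : Multiset R, T ≤ S ∧ m ≤ Multiset.card T ∧ T.esymm m = 0

/-- The `m`-th degree Davenport constant `D_m(R)`: the smallest positive integer `z` such that
every sequence `S` over `R` of length at least `z` has a subsequence `T` of length at least `m`
with `e_m(T) = 0`. Its value is `⊤` if there is no such `z`. -/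
noncomputable def davenportConst (m : ℕ) (R : Type*) [CommRing R] : ℕ∞ :=
  sInf ((fun z : ℕ => (z : ℕ∞)) ''
    {z : ℕ | 0 < z ∧ ∀ S : Multiset R, z ≤ Multiset.card S → HasVanishingSubseq m S})

/-! As `k` is odd, `e_2(T) = 0` means `(∑ x)^2 = ∑ x^2` mod `k`. Two terms divisible by `r` have
product `0`, since `k ∣ r^2`. Otherwise at least `k + r - 1` terms are prime to this case, and
Olson's theorem for `C_r ⊕ C_k`, applied to the pairs `(x, x^2)`, makes both sides vanish. Olson's
bound comes from Chevalley–Warning over `C_p`, lifted by induction on the smaller modulus. -/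

open Finset in
/-- The Davenport constant of `C_p ^ d` is at most `d * (p - 1) + 1`. -/
theorem exists_nonempty_subset_prime_dvd_sum {ι κ : Type*} [Fintype κ] {p : ℕ} (hp : p.Prime)
    (s : Finset ι) (f : κ → ι → ℤ) (hs : Fintype.card κ * (p - 1) < #s) :
    ∃ t ⊆ s, t.Nonempty ∧ ∀ j, (p : ℤ) ∣ ∑ i ∈ t, f j i := by
  classical
  have : Fact p.Prime := ⟨hp⟩
  -- By Fermat, `X ^ (p - 1)` is the indicator of `X ≠ 0`, so the support of a nonzero common root
  -- is the required subset.
  let F : κ → MvPolynomial s (ZMod p) := fun j =>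
    ∑ i : s, ((f j i : ℤ) : ZMod p) • MvPolynomial.X i ^ (p - 1)
  have hdeg : ∑ j, (F j).totalDegree < Fintype.card s := by
    calc ∑ j, (F j).totalDegree ≤ ∑ _j : κ, (p - 1) := by
          refine sum_le_sum fun j _ => MvPolynomial.totalDegree_finsetSum_le fun i _ => ?_
          exact (MvPolynomial.totalDegree_smul_le ..).trans
            (MvPolynomial.totalDegree_X_pow ..).le
      _ = Fintype.card κ * (p - 1) := by simp
      _ < Fintype.card s := by simpa using hs
  have hdvd := char_dvd_card_solutions_of_fintype_sum_lt p hdeg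
  let z : {x : s → ZMod p // ∀ j, MvPolynomial.eval x (F j) = 0} :=
    ⟨0, by simp [F, map_sum, hp.one_lt, tsub_eq_zero_iff_le]⟩
  obtain ⟨x, hx⟩ := Fintype.exists_ne_of_one_lt_card
    (hp.one_lt.trans_le <| Nat.le_of_dvd (@Fintype.card_pos _ _ ⟨z⟩) hdvd) z
  refine ⟨({a | x.1 a ≠ 0} : Finset s).map ⟨(↑), Subtype.val_injective⟩, ?_, ?_, fun j => ?_⟩
  · simp +contextual [subset_iff]
  · rw [map_nonempty]
    rw [← Subtype.coe_ne_coe, Function.ne_iff] at hx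
    exact hx.imp fun a ha => mem_filter.2 ⟨mem_univ _, ha⟩
  · rw [← ZMod.intCast_zmod_eq_zero_iff_dvd]
    simpa [F, ZMod.pow_card_sub_one, sum_filter] using x.2 j

open Finset in
/-- The Davenport constant of `C_p ^ 2` is at most `2 * p - 1`. -/
theorem exists_nonempty_subset_prime_dvd_sum_pair {ι : Type*} {p : ℕ} (hp : p.Prime)
    (s : Finset ι) (f g : ι → ℤ) (hs : 2 * p - 1 ≤ #s) :
    ∃ t ⊆ s, t.Nonempty ∧ (p : ℤ) ∣ ∑ i ∈ t, f i ∧ (p : ℤ) ∣ ∑ i ∈ t, g i := by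
  have := hp.two_le
  obtain ⟨t, hts, ht, h⟩ := exists_nonempty_subset_prime_dvd_sum hp s ![f, g]
    (by simp only [Fintype.card_fin]; omega)
  exact ⟨t, hts, ht, h 0, h 1⟩

open Finset in
/-- Any `3 * p - 2` elements of `C_p ^ 2` have a nonempty zero-sum subsequence of length at most
`p`. -/
theorem exists_short_subset_prime_dvd_sum_pair {ι : Type*} {p : ℕ} (hp : p.Prime)
    (s : Finset ι) (f g : ι → ℤ) (hs : 3 * p - 2 ≤ #s) :
    ∃ t ⊆ s, t.Nonempty ∧ #t ≤ p ∧ (p : ℤ) ∣ ∑ i ∈ t, f i ∧ (p : ℤ) ∣ ∑ i ∈ t, g i := by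
  classical
  have h2 := hp.two_le
  obtain ⟨s', hs's, hs'⟩ := exists_subset_card_eq hs
  -- The constant coordinate forces `p ∣ #t`, so `#t` is `p` or `2 * p`.
  obtain ⟨t, hts, ht, h⟩ := exists_nonempty_subset_prime_dvd_sum hp s' ![f, g, fun _ => 1]
    (by simp only [Fintype.card_fin]; omega)
  have hf : (p : ℤ) ∣ ∑ i ∈ t, f i := h 0
  have hg : (p : ℤ) ∣ ∑ i ∈ t, g i := h 1
  have hc : p ∣ #t := by simpa [Int.natCast_dvd_natCast] using h 2
  have hle := card_le_card hts
  obtain ⟨c, hc⟩ := hc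
  have hc3 : c < 3 := by
    by_contra!
    nlinarith [Nat.mul_le_mul_left p this, show #t + 2 ≤ 3 * p by omega]
  by_cases hc1 : c ≤ 1
  · exact ⟨t, hts.trans hs's, ht, by nlinarith, hf, hg⟩
  obtain rfl : c = 2 := by omega
  -- Erasing one element keeps `t \ u` nonempty; one of `u`, `t \ u` has size at most `p`.
  obtain ⟨u, hut, hu, hfu, hgu⟩ := exists_nonempty_subset_prime_dvd_sum_pair hp
    (t.erase ht.choose) f g (by rw [card_erase_of_mem ht.choose_spec]; omega)
  have hut' : u ⊆ t := hut.trans (erase_subset _ _)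
  by_cases hup : #u ≤ p
  · exact ⟨u, (hut'.trans hts).trans hs's, hu, hup, hfu, hgu⟩
  refine ⟨t \ u, (sdiff_subset.trans hts).trans hs's,
    ⟨ht.choose, mem_sdiff.2 ⟨ht.choose_spec, fun hmem => notMem_erase _ _ (hut hmem)⟩⟩, ?_, ?_, ?_⟩
  · rw [card_sdiff_of_subset hut']; omega
  · rw [← sum_sdiff hut'] at hf
    exact (dvd_add_left hfu).1 hf
  · rw [← sum_sdiff hut'] at hg
    exact (dvd_add_left hgu).1 hg

open Finset in
/-- A set of `p * (n + 2) - 1` elements of `C_p ^ 2` contains `n + 1` disjoint nonempty zero-sum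
subsequences. -/
theorem exists_disjoint_subsets_prime_dvd_sum_pair {ι : Type*} {p : ℕ} (hp : p.Prime)
    (f g : ι → ℤ) (n : ℕ) (s : Finset ι) (hs : p * (n + 2) - 1 ≤ #s) :
    ∃ T : Finset (Finset ι), #T = n + 1 ∧ (T : Set (Finset ι)).PairwiseDisjoint id ∧
      ∀ t ∈ T, t ⊆ s ∧ t.Nonempty ∧ (p : ℤ) ∣ ∑ i ∈ t, f i ∧ (p : ℤ) ∣ ∑ i ∈ t, g i := by
  classical
  have h2 := hp.two_le
  induction n generalizing s with
  | zero =>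
    obtain ⟨t, ht⟩ := exists_nonempty_subset_prime_dvd_sum_pair hp s f g (by omega)
    exact ⟨{t}, by simp, by simp, by simpa using ht⟩
  | succ n ih =>
    have e : p * (n + 1 + 2) = p * n + 3 * p := by ring
    have e' : p * (n + 2) = p * n + 2 * p := by ring
    obtain ⟨t, hts, ht, htp, hft, hgt⟩ :=
      exists_short_subset_prime_dvd_sum_pair hp s f g (by omega)
    obtain ⟨T, hT, hdisj, hsum⟩ := ih (s \ t) (by rw [card_sdiff_of_subset hts]; omega)
    have htT : ∀ u ∈ T, Disjoint t u := fun u hu =>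
      (disjoint_sdiff : Disjoint t (s \ t)).mono_right (hsum u hu).1
    have htn : t ∉ T := fun hmem => ht.ne_empty (disjoint_self.1 (htT t hmem))
    refine ⟨insert t T, by rw [card_insert_of_notMem htn, hT], ?_, ?_⟩
    · rw [coe_insert]
      exact hdisj.insert fun u hu _ => htT u hu
    · intro u hu
      rcases mem_insert.1 hu with rfl | hu
      · exact ⟨hts, ht, hft, hgt⟩
      · obtain ⟨h, h'⟩ := hsum u hu
        exact ⟨h.trans sdiff_subset, h'⟩

open Finset in
/-- The Davenport constant of `C_n` is at most `n`. -/
theorem exists_nonempty_subset_dvd_sum {ι : Type*} {n : ℕ} (hn : 0 < n) (s : Finset ι)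
    (f : ι → ℤ) (hs : n ≤ #s) : ∃ t ⊆ s, t.Nonempty ∧ (n : ℤ) ∣ ∑ i ∈ t, f i := by
  classical
  -- Padding with `n - 1` zeros reaches length `2 * n - 1`; the `n` chosen terms cannot all be
  -- padding.
  obtain ⟨t, hts, ht, hsum⟩ := Int.erdos_ginzburg_ziv (n := n)
    (s := s.disjSum (univ : Finset (Fin (n - 1)))) (Sum.elim f fun _ => 0)
    (by rw [card_disjSum]; simp; omega)
  refine ⟨t.toLeft, fun i hi => ?_, ?_, ?_⟩
  · simpa using hts (mem_toLeft.1 hi)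
  · rw [← card_pos]
    have h1 := card_toLeft_add_card_toRight (u := t)
    have h2 := card_le_univ t.toRight
    rw [Fintype.card_fin] at h2
    omega
  · rw [sum_sum_eq_sum_toLeft_add_sum_toRight] at hsum
    simpa using hsum

open Finset in
/-- **Olson's theorem** (upper bound): for `a ∣ b`, the Davenport constant of `C_a ⊕ C_b` is at most
`a + b - 1`. -/
theorem exists_nonempty_subset_dvd_sum_pair {a b : ℕ} (hb : 0 < b) (hab : a ∣ b) {ι : Type*}
    (s : Finset ι) (f g : ι → ℤ) (hs : a + b - 1 ≤ #s) :
    ∃ t ⊆ s, t.Nonempty ∧ (a : ℤ) ∣ ∑ i ∈ t, f i ∧ (b : ℤ) ∣ ∑ i ∈ t, g i := by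
  classical
  induction a using Nat.strong_induction_on generalizing b ι with
  | _ a ih =>
    have ha : 0 < a := Nat.pos_of_dvd_of_pos hab hb
    by_cases ha1 : a = 1
    · subst ha1
      obtain ⟨t, hts, ht, h⟩ := exists_nonempty_subset_dvd_sum hb s g (by omega)
      exact ⟨t, hts, ht, by simp, h⟩
    obtain ⟨p, hp, a', rfl⟩ := Nat.exists_prime_and_dvd ha1
    obtain ⟨b', rfl⟩ : p ∣ b := (dvd_mul_right p a').trans hab
    have hp0 := hp.pos
    have ha' : 0 < a' := Nat.pos_of_mul_pos_left ha
    have hb' : 0 < b' := Nat.pos_of_mul_pos_left hb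
    have hab' : a' ∣ b' := Nat.dvd_of_mul_dvd_mul_left hp0 hab
    -- This yields `a' + b' - 1` blocks; their sums divided by `p` feed the induction for `(a',
    -- b')`.
    obtain ⟨T, hT, hdisj, hsum⟩ := exists_disjoint_subsets_prime_dvd_sum_pair hp f g
      (a' + b' - 2) s (by rwa [show a' + b' - 2 + 2 = a' + b' by omega, mul_add])
    obtain ⟨U, hUT, hU, hfU, hgU⟩ := ih a' (lt_mul_of_one_lt_left ha' hp.one_lt) hb' hab' T
      (fun t => (∑ i ∈ t, f i) / p) (fun t => (∑ i ∈ t, g i) / p) (by omega)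
    have hdisjU : (U : Set (Finset ι)).PairwiseDisjoint id := hdisj.subset (by exact_mod_cast hUT)
    have key : ∀ h : ι → ℤ, (∀ t ∈ U, (p : ℤ) ∣ ∑ i ∈ t, h i) →
        ∑ i ∈ U.biUnion id, h i = p * ∑ t ∈ U, (∑ i ∈ t, h i) / p := fun h hh => by
      rw [sum_biUnion hdisjU, mul_sum]
      exact sum_congr rfl fun t ht => (Int.mul_ediv_cancel' (hh t ht)).symm
    refine ⟨U.biUnion id, biUnion_subset.2 fun t ht => (hsum t (hUT ht)).1, ?_, ?_, ?_⟩
    · obtain ⟨t, ht⟩ := hU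
      obtain ⟨i, hi⟩ := (hsum t (hUT ht)).2.1
      exact ⟨i, mem_biUnion.2 ⟨t, ht, hi⟩⟩
    · rw [key f fun t ht => (hsum t (hUT ht)).2.2.1, Nat.cast_mul]
      exact mul_dvd_mul_left _ hfU
    · rw [key g fun t ht => (hsum t (hUT ht)).2.2.2, Nat.cast_mul]
      exact mul_dvd_mul_left _ hgU

theorem Multiset.two_mul_esymm_two {R : Type*} [CommRing R] (T : Multiset R) :
    2 * T.esymm 2 = T.sum ^ 2 - (T.map (· ^ 2)).sum := by
  induction T using Multiset.induction with
  | empty => simp [Multiset.esymm, Multiset.powersetCard_zero_right]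
  | cons a T ih =>
    have h : (a ::ₘ T).esymm 2 = T.esymm 2 + a * T.sum := by
      simp [Multiset.esymm, Multiset.powersetCard_cons, Multiset.powersetCard_one]
      simpa using T.sum_map_mul_left (f := id) (a := a)
    rw [h, mul_add, ih, Multiset.sum_cons, Multiset.map_cons, Multiset.sum_cons]
    ring

open Finset in
theorem hasVanishingSubseq_two {k r : ℕ} (hk : Odd k) (hrk : r ∣ k) (hkr : k ∣ r ^ 2)
    (S : Multiset (ZMod k)) (hS : k + r ≤ Multiset.card S) : HasVanishingSubseq 2 S := by
  classical
  obtain ⟨n, x, rfl⟩ : ∃ (n : ℕ) (x : Fin n → ℤ),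
      S = (univ : Finset (Fin n)).val.map fun i => (x i : ZMod k) := by
    obtain ⟨l, rfl⟩ := Quot.exists_rep S
    choose y hy using fun i => ZMod.intCast_surjective (l.get i)
    refine ⟨l.length, y, ?_⟩
    simp only [hy]
    rw [Fin.univ_val_map, List.ofFn_get]
    rfl
  have hn : k + r ≤ n := by simpa using hS
  have suff : ∀ t : Finset (Fin n), 1 < #t → (k : ℤ) ∣ (∑ i ∈ t, x i) ^ 2 - ∑ i ∈ t, x i ^ 2 →
      HasVanishingSubseq 2 ((univ : Finset (Fin n)).val.map fun i => (x i : ZMod k)) := by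
    intro t ht hdvd
    refine ⟨t.val.map fun i => (x i : ZMod k),
      Multiset.map_le_map (val_le_iff.2 (subset_univ t)), by simpa using Nat.succ_le_of_lt ht, ?_⟩
    have h2 : IsUnit (2 : ZMod k) := by
      have := (ZMod.isUnit_iff_coprime 2 k).2 (Nat.coprime_two_left.2 hk)
      exact_mod_cast this
    refine h2.mul_right_eq_zero.1 ?_
    rw [Multiset.two_mul_esymm_two, Multiset.map_map]
    have := (ZMod.intCast_zmod_eq_zero_iff_dvd _ k).2 hdvd
    push_cast at this
    exact this
  let B : Finset (Fin n) := {i | (r : ℤ) ∣ x i}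
  have hkr' : (k : ℤ) ∣ (r : ℤ) ^ 2 := by exact_mod_cast hkr
  by_cases hB : 1 < #B
  · obtain ⟨i, hi, j, hj, hij⟩ := one_lt_card.1 hB
    refine suff {i, j} (by rw [card_pair hij]; omega) ?_
    rw [sum_pair hij, sum_pair hij, show (x i + x j) ^ 2 - (x i ^ 2 + x j ^ 2) = 2 * (x i * x j) by
      ring]
    refine dvd_mul_of_dvd_right (hkr'.trans ?_) _
    rw [sq]
    exact mul_dvd_mul (mem_filter.1 hi).2 (mem_filter.1 hj).2
  · obtain ⟨t, htB, ht, h1, h2⟩ := exists_nonempty_subset_dvd_sum_pair hk.pos hrk Bᶜ x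
      (fun i => x i ^ 2) (by rw [card_compl, Fintype.card_fin]; omega)
    refine suff t ?_ (dvd_sub (hkr'.trans (pow_dvd_pow_of_dvd h1 2)) h2)
    -- A singleton `t` would be a term divisible by `r`, but `t` avoids `B`.
    by_contra! hcard
    obtain ⟨i, rfl⟩ := card_eq_one.1 (le_antisymm hcard ht.card_pos)
    rw [sum_singleton] at h1
    exact mem_compl.1 (htB (mem_singleton_self i)) (mem_filter.2 ⟨mem_univ i, h1⟩)

theorem mainTheorem7 (k r : ℕ) (hk : Odd k) (hrk : r ∣ k) (hkr : k ∣ r ^ 2) :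
    davenportConst 2 (ZMod k) ≤ ((k + r : ℕ) : ℕ∞) :=
  sInf_le ⟨k + r, ⟨Nat.add_pos_left hk.pos r, hasVanishingSubseq_two hk hrk hkr⟩, rfl⟩
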